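/- For a finite simple graph $G$, let the jump graph $J(G)$ be the graph whose vertices are the edges of $G$, two of them being adjacent if and only if the corresponding edges of $G$ have no endpoint in common. Put $J^0(G)=G$ and $J^k(G)=J(J^{k-1}(G))$ for $k\ge 1$. Let the dissipation number $d(G)$ be the smallest $k\ge 0$ such that $J^k(G)$ is the empty graph (the graph with no vertices), with $d(G)=\infty$ if there is no such $k$. For a graph $H$, say that $G$ accumulates $H$ if there is some $k\ge 0$ such that $J^k(G)$ contains a (not necessarily induced) subgraph isomorphic to $H$. Let $C_5$ be the cycle on five vertices, and let the net graph $N$ be the graph on six vertices consisting of a triangle with one pendant edge attached to each of its three vertices. Theorem (Accumulation Theorem). For every finite simple graph $G$, $d(G)=\infty$ if and only if $G$ accumulates $C_5$ or $G$ accumulates $N$. -/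

import Mathlib

open scoped SimpleGraph

universe u v

/-- The jump graph `J(G)`: its vertices are the edges of `G`, and two of them are adjacent if and
only if the corresponding edges of `G` have no endpoint in common. -/
def jumpGraph {V : Type u} (G : SimpleGraph V) : SimpleGraph G.edgeSet where
  Adj e f := ¬ ∃ x : V, x ∈ (e : Sym2 V) ∧ x ∈ (f : Sym2 V)
  symm := ⟨fun _ _ h ⟨x, hf, he⟩ => h ⟨x, he, hf⟩⟩
  loopless := ⟨fun e h => h ⟨(e : Sym2 V).out.1, Sym2.out_fst_mem _, Sym2.out_fst_mem _⟩⟩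

/-- The iterated jump graphs, each bundled with its vertex type:
`J^0(G) = G` and `J^(k+1)(G) = J(J^k(G))`. -/
def iterJump {V : Type u} (G : SimpleGraph V) : ℕ → Σ W : Type u, SimpleGraph W
  | 0 => ⟨V, G⟩
  | k + 1 => ⟨(iterJump G k).2.edgeSet, jumpGraph (iterJump G k).2⟩

/-- The dissipation number `d(G)`: the least `k` for which `J^k(G)` is the empty graph (the graph
without vertices), and `⊤` if there is no such `k`. -/
noncomputable def dissipationNumber {V : Type u} (G : SimpleGraph V) : ℕ∞ :=
  sInf {n : ℕ∞ | ∃ k : ℕ, n = (k : ℕ∞) ∧ IsEmpty (iterJump G k).1}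

/-- `G` is `d`-infinite if its dissipation number is infinite. -/
def DInfinite {V : Type u} (G : SimpleGraph V) : Prop :=
  dissipationNumber G = ⊤

/-- `G` accumulates `H` if some iterated jump graph of `G` has a (not necessarily induced)
subgraph isomorphic to `H`. -/
def Accumulates {V : Type u} {W : Type v} (G : SimpleGraph V) (H : SimpleGraph W) : Prop :=
  ∃ k : ℕ, H ⊑ (iterJump G k).2

/-- The net graph `N`: the triangle `0, 1, 2` with one pendant edge at each of its vertices. -/
def netGraph : SimpleGraph (Fin 6) :=
  SimpleGraph.fromEdgeSet {s(0, 1), s(1, 2), s(0, 2), s(0, 3), s(1, 4), s(2, 5)}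

/-! Taking jump graphs preserves subgraph containment and ignores isolated vertices. The pentagon
and the net are each contained in their own jump graph, so once either appears, no iterate is empty
(`nonempty_of_contains`).

Conversely, suppose that no iterate is empty. An edge of J²(G) is a pair of disjoint edges of J(G),
that is, four edges of G forming two disjoint pairs; this leaves six possible four-edge subgraphs
(`exists_transientFour`). Each of them dissipates, so G has a further edge, and `Contains.grow` runs
through its possible positions: a graph of the next transient list or a persistent graph arises.
After six edges no transient graph remains, so G contains a persistent one. Each persistent graph
contains the pentagon or the net, or its jump graph contains a later persistent graph, so iteration
reaches one of the two targets (`accumulating_of_descends`).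

The case distinctions are computations on edge lists; the lemmas transfer their outcomes to
arbitrary graphs. -/

/-! ### Edge lists

Small graphs are described by lists of edges between natural numbers. -/

/-- A finite graph without isolated vertices, given by the list of its edges. -/
abbrev EdgeList := List (ℕ × ℕ)

namespace EdgeList

/-- The assignment `a ↦ c` does not conflict with the partial bijection `s`. -/
def fits (s : List (ℕ × ℕ)) (a c : ℕ) : Bool :=
  s.all fun x => bif x.1.beq a then x.2.beq c else !x.2.beq c

/-- Searches for an extension of the partial bijection `s` that maps the edges of an edge list
to edges of `L`. -/
def embedsFrom (L : EdgeList) : EdgeList → List (ℕ × ℕ) → Bool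
  | [], _ => true
  | (a, b) :: F, s => L.any fun q =>
      (fits s a q.1 && fits s b q.2 && embedsFrom L F ((a, q.1) :: (b, q.2) :: s)) ||
      (fits s a q.2 && fits s b q.1 && embedsFrom L F ((a, q.2) :: (b, q.1) :: s))

/-- The number of vertices below `10` that have degree at least `k`. -/
def countDegree (L : EdgeList) (k : ℕ) : ℕ :=
  (List.range 10).countP fun v => k.ble (L.countP fun p => p.1.beq v || p.2.beq v)

/-- The graph `F` has at most as many vertices of degree at least `k` as `L`, for each `k ≤ 4`.
This rules out most candidates for a subgraph `F` of `L` quickly. -/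
def degreesFit (F L : EdgeList) : Bool :=
  (countDegree F 1).ble (countDegree L 1) && (countDegree F 2).ble (countDegree L 2) &&
  (countDegree F 3).ble (countDegree L 3) && (countDegree F 4).ble (countDegree L 4)

/-- The search finds `F` as a subgraph of `L`. -/
def embeds (F L : EdgeList) : Bool := degreesFit F L && embedsFrom L F []

/-- The pairs `p` and `q` have no entry in common. -/
def disjointPairs (p q : ℕ × ℕ) : Bool :=
  !p.1.beq q.1 && !p.1.beq q.2 && !p.2.beq q.1 && !p.2.beq q.2

/-- The pairs `p` and `q` are equal up to order. -/
def samePair (p q : ℕ × ℕ) : Bool :=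
  (p.1.beq q.1 && p.2.beq q.2) || (p.1.beq q.2 && p.2.beq q.1)

/-- No edge is listed twice. -/
def simple (L : EdgeList) : Bool :=
  L.zipIdx.all fun x => L.zipIdx.all fun y => x.2.beq y.2 || !samePair x.1 y.1

/-- The jump graph of an edge list; its vertices are the positions in the list. -/
def jump (L : EdgeList) : EdgeList :=
  L.zipIdx.flatMap fun x => (L.zipIdx.filter fun y =>
    Nat.blt x.2 y.2 && disjointPairs x.1 y.1).map fun y => (x.2, y.2)

/-- One of the first `n` iterated jump graphs of `L` has no edges. -/
def dissipates : ℕ → EdgeList → Bool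
  | 0, L => L.isEmpty
  | n + 1, L => L.isEmpty || (simple L && dissipates n (jump L))

/-- The possible ends of a new edge when the vertices used so far are among `0, …, n - 1`. -/
def newEdges (n : ℕ) : List (ℕ × ℕ) :=
  (n, n + 1) :: (List.range (n + 1)).flatMap fun b => (List.range b).map fun a => (a, b)

/-- A strict upper bound for the vertices of `L`. -/
def bound (L : EdgeList) : ℕ := L.foldr (fun p n => max (max p.1 p.2 + 1) n) 0

/-- Each graph obtained from `L` by adding an edge contains one of the `targets`. -/
def grows (targets : List EdgeList) (L : EdgeList) : Bool :=
  (newEdges (bound L)).all fun q =>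
    L.any (samePair q) || targets.any fun F => embeds F (q :: L)

/-- The pentagon `C₅`. -/
def pentagon : EdgeList := [(0, 1), (1, 2), (2, 3), (3, 4), (4, 0)]

/-- The net graph. -/
def net : EdgeList := [(0, 1), (1, 2), (0, 2), (0, 3), (1, 4), (2, 5)]

/-- Each listed graph contains the pentagon or the net, or its jump graph contains a graph that
is listed later. -/
def descends : List EdgeList → Bool
  | [] => true
  | F :: T => (embeds pentagon F || embeds net F ||
      (simple F && T.any fun F' => embeds F' (jump F))) && descends T

/-- The minimal graphs with infinite dissipation number. -/
def persistent : List EdgeList :=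
  [[(0, 1), (2, 3), (4, 5), (6, 7), (8, 9)],
   [(0, 1), (1, 2), (3, 4), (5, 6), (7, 8)],
   [(0, 1), (1, 2), (3, 4), (4, 5), (6, 7)],
   [(0, 1), (1, 2), (2, 3), (4, 5), (6, 7)],
   [(0, 1), (1, 2), (2, 3), (4, 5), (5, 6)],
   [(0, 1), (1, 2), (1, 3), (4, 5), (6, 7)],
   [(0, 1), (0, 2), (1, 2), (3, 4), (5, 6)],
   [(0, 1), (0, 2), (1, 2), (3, 4), (4, 5)],
   [(0, 1), (1, 2), (1, 3), (0, 3), (2, 3), (4, 5)],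
   [(0, 1), (1, 2), (1, 3), (2, 3), (1, 4), (1, 5), (4, 5)],
   [(0, 1), (1, 2), (1, 3), (4, 5), (5, 6)],
   [(0, 1), (1, 2), (1, 3), (0, 4), (2, 4), (3, 4)],
   [(0, 1), (1, 2), (1, 3), (2, 3), (1, 4), (2, 4), (3, 4)],
   [(0, 1), (1, 2), (2, 3), (3, 4), (5, 6)],
   [(0, 1), (1, 2), (1, 3), (1, 4), (0, 5), (2, 6)],
   [(0, 1), (1, 2), (1, 3), (1, 4), (3, 4), (5, 6)],
   [(0, 1), (1, 2), (1, 3), (1, 4), (3, 5), (4, 5)],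
   [(0, 1), (1, 2), (1, 3), (2, 4), (3, 4), (4, 5)],
   [(0, 1), (1, 2), (2, 3), (3, 4), (4, 5)],
   [(0, 1), (0, 2), (1, 3), (2, 4), (3, 4)],
   [(0, 1), (1, 2), (1, 3), (2, 3), (2, 4), (3, 5)]]

/-- The graphs with four edges and dissipation number at least `4`. -/
def transientFour : List EdgeList :=
  [[(0, 1), (0, 2), (1, 3), (2, 3)],
   [(0, 1), (1, 2), (2, 3), (3, 4)],
   [(0, 1), (1, 2), (2, 3), (4, 5)],
   [(0, 1), (1, 2), (3, 4), (4, 5)],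
   [(0, 1), (1, 2), (3, 4), (5, 6)],
   [(0, 1), (2, 3), (4, 5), (6, 7)]]

/-- The graphs with five edges that have finite dissipation number at least `4`. -/
def transientFive : List EdgeList :=
  [[(0, 1), (1, 2), (1, 3), (0, 3), (2, 3)],
   [(0, 1), (1, 2), (1, 3), (2, 3), (0, 4)],
   [(0, 1), (1, 2), (1, 3), (2, 3), (3, 4)],
   [(0, 1), (1, 2), (1, 3), (2, 3), (4, 5)],
   [(0, 1), (1, 2), (1, 3), (2, 4), (3, 4)],
   [(0, 1), (0, 2), (1, 3), (2, 3), (4, 5)],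
   [(0, 1), (1, 2), (1, 3), (0, 4), (4, 5)],
   [(0, 1), (1, 2), (1, 3), (0, 4), (2, 5)],
   [(0, 1), (1, 2), (1, 3), (3, 4), (3, 5)],
   [(0, 1), (1, 2), (1, 3), (0, 4), (5, 6)]]

/-- The graphs with six edges that have finite dissipation number at least `4`. -/
def transientSix : List EdgeList :=
  [[(0, 1), (0, 2), (1, 2), (0, 3), (1, 3), (2, 3)],
   [(0, 1), (1, 2), (1, 3), (2, 3), (2, 4), (3, 4)],
   [(0, 1), (1, 2), (1, 3), (1, 4), (2, 4), (3, 4)],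
   [(0, 1), (1, 2), (0, 2), (1, 3), (1, 4), (3, 4)],
   [(0, 1), (1, 2), (1, 3), (2, 3), (1, 4), (0, 5)],
   [(0, 1), (1, 2), (0, 2), (1, 3), (1, 4), (2, 5)]]

/-! ### Finite verifications -/

theorem descends_persistent : descends persistent = true := by
  decide +kernel

theorem dissipates_of_transient :
    (transientFour ++ transientFive ++ transientSix).all (dissipates 7) = true := by
  decide +kernel

theorem grows_transientFour :
    transientFour.all (grows (transientFive ++ persistent)) = true := by
  decide +kernel

theorem grows_transientFive :
    transientFive.all (grows (transientSix ++ persistent)) = true := by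
  decide +kernel

theorem grows_transientSix : transientSix.all (grows persistent) = true := by
  decide +kernel

/-- Four edges that form two disjoint pairs contain one of the graphs in `transientFour`. -/
theorem two_disjoint_pairs :
    ((newEdges 2).all fun q => !disjointPairs (0, 1) q || (newEdges (max 2 (q.2 + 1))).all fun r =>
      samePair (0, 1) r || samePair q r ||
      (newEdges (max (max 2 (q.2 + 1)) (r.2 + 1))).all fun t =>
        samePair (0, 1) t || samePair q t || !disjointPairs r t ||
        transientFour.any fun F => embeds F [(0, 1), q, r, t]) = true := by
  decide +kernel

theorem embeds_pentagon_jump : (simple pentagon && embeds pentagon (jump pentagon)) = true := by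
  decide +kernel

theorem embeds_net_jump : (simple net && embeds net (jump net)) = true := by
  decide +kernel

/-! ### Edge lists contained in a graph -/

section Contains

variable {V : Type u}

/-- `R` relates each element to at most one element, in both directions. -/
def IsPartialBij {α : Type*} {β : Type*} (R : α → β → Prop) : Prop :=
  ∀ ⦃a u b v⦄, R a u → R b v → (a = b ↔ u = v)

/-- The ends of `e` correspond to the entries of `p` under `R`. -/
def MapsTo (R : ℕ → V → Prop) (p : ℕ × ℕ) (e : Sym2 V) : Prop :=
  ∃ u v, e = s(u, v) ∧ R p.1 u ∧ R p.2 v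

/-- `R` maps the edges of `L` to edges of `G`. -/
def Realizes (G : SimpleGraph V) (R : ℕ → V → Prop) (L : EdgeList) : Prop :=
  IsPartialBij R ∧ ∀ p ∈ L, ∃ e ∈ G.edgeSet, MapsTo R p e

/-- `G` has a (not necessarily induced) subgraph with the listed edges. -/
def Contains (G : SimpleGraph V) (L : EdgeList) : Prop := ∃ R, Realizes G R L

/-- Up to isolated vertices, `G` is the graph with the listed edges. -/
def IsGraph (G : SimpleGraph V) (L : EdgeList) : Prop :=
  ∃ R, Realizes G R L ∧ ∀ e ∈ G.edgeSet, ∃ p ∈ L, MapsTo R p e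

theorem beq_eq_false_iff {a b : ℕ} : a.beq b = false ↔ a ≠ b := by
  rw [← Bool.not_eq_true, Nat.beq_eq]

variable {G : SimpleGraph V} {R : ℕ → V → Prop} {p q : ℕ × ℕ} {e f : Sym2 V} {L F : EdgeList}

theorem MapsTo.mono {R' : ℕ → V → Prop} (h : ∀ a u, R a u → R' a u) (he : MapsTo R p e) :
    MapsTo R' p e := by
  obtain ⟨u, v, rfl, hu, hv⟩ := he
  exact ⟨u, v, rfl, h _ _ hu, h _ _ hv⟩

theorem disjointPairs_iff (hR : IsPartialBij R) (he : MapsTo R p e) (hf : MapsTo R q f) :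
    disjointPairs p q = true ↔ ¬ ∃ x, x ∈ e ∧ x ∈ f := by
  obtain ⟨u, v, rfl, hu, hv⟩ := he
  obtain ⟨u', v', rfl, hu', hv'⟩ := hf
  have h1 := hR hu hu'
  have h2 := hR hu hv'
  have h3 := hR hv hu'
  have h4 := hR hv hv'
  simp only [disjointPairs, Bool.and_eq_true, Bool.not_eq_true', beq_eq_false_iff, ne_eq,
    Sym2.mem_iff, h1, h2, h3, h4]
  constructor
  · rintro ⟨⟨⟨h1, h2⟩, h3⟩, h4⟩ ⟨x, rfl | rfl, h | h⟩
    exacts [h1 h, h2 h, h3 h, h4 h]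
  · intro h
    exact ⟨⟨⟨fun hc => h ⟨u, .inl rfl, .inl hc⟩, fun hc => h ⟨u, .inl rfl, .inr hc⟩⟩,
      fun hc => h ⟨v, .inr rfl, .inl hc⟩⟩, fun hc => h ⟨v, .inr rfl, .inr hc⟩⟩

theorem samePair_iff (hR : IsPartialBij R) (he : MapsTo R p e) (hf : MapsTo R q f) :
    samePair p q = true ↔ e = f := by
  obtain ⟨u, v, rfl, hu, hv⟩ := he
  obtain ⟨u', v', rfl, hu', hv'⟩ := hf
  simp only [samePair, Bool.or_eq_true, Bool.and_eq_true, Nat.beq_eq, Sym2.eq_iff, hR hu hu',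
    hR hu hv', hR hv hu', hR hv hv']

theorem fits_iff {s : List (ℕ × ℕ)} {a c : ℕ} :
    fits s a c = true ↔ ∀ x ∈ s, (x.1 = a ↔ x.2 = c) := by
  simp only [fits, List.all_eq_true]
  refine forall₂_congr fun x _ => ?_
  by_cases h : x.1 = a <;> simp [h, beq_eq_false_iff]

/-- Soundness of the search, the only direction needed: the assignments accumulated on a successful
branch form `t`. -/
theorem exists_of_embedsFrom {F : EdgeList} {s : List (ℕ × ℕ)} (hL : ∀ q ∈ L, q.1 ≠ q.2)
    (hF : ∀ p ∈ F, p.1 ≠ p.2) (hs : IsPartialBij fun a c => (a, c) ∈ s)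
    (h : embedsFrom L F s = true) :
    ∃ t : List (ℕ × ℕ), s ⊆ t ∧ IsPartialBij (fun a c => (a, c) ∈ t) ∧
      ∀ p ∈ F, ∃ q ∈ L, ∃ c d, (c, d) ∈ [(q.1, q.2), (q.2, q.1)] ∧
        (p.1, c) ∈ t ∧ (p.2, d) ∈ t := by
  induction F generalizing s with
  | nil => exact ⟨s, List.Subset.refl s, hs, by simp⟩
  | cons p F ih =>
    obtain ⟨a, b⟩ := p
    have step : ∀ c d, c ≠ d → fits s a c = true → fits s b d = true →
        IsPartialBij fun x y => (x, y) ∈ (a, c) :: (b, d) :: s := by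
      intro c d hcd h1 h2 x u y v hx hy
      have hab : a ≠ b := hF (a, b) (by simp)
      rw [fits_iff] at h1 h2
      have h1' := fun z w hz => h1 (z, w) hz
      have h2' := fun z w hz => h2 (z, w) hz
      simp only [List.mem_cons, Prod.mk.injEq] at hx hy
      have := @hs x u y v
      grind
    have fin : ∀ q ∈ L, ∀ c d, (c, d) ∈ [(q.1, q.2), (q.2, q.1)] → c ≠ d →
        fits s a c = true → fits s b d = true →
        embedsFrom L F ((a, c) :: (b, d) :: s) = true →
        ∃ t : List (ℕ × ℕ), s ⊆ t ∧ IsPartialBij (fun a c => (a, c) ∈ t) ∧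
          ∀ p ∈ (a, b) :: F, ∃ q ∈ L, ∃ c d, (c, d) ∈ [(q.1, q.2), (q.2, q.1)] ∧
            (p.1, c) ∈ t ∧ (p.2, d) ∈ t := by
      intro q hq c d hm hcd h1 h2 h3
      obtain ⟨t, hst, ht, hFt⟩ := ih (fun p hp => hF p (by simp [hp])) (step c d hcd h1 h2) h3
      refine ⟨t, fun x hx => hst (by simp [hx]), ht, ?_⟩
      intro p hp
      rcases List.mem_cons.1 hp with rfl | hp
      · exact ⟨q, hq, c, d, hm, hst (by simp), hst (by simp)⟩
      · exact hFt p hp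
    simp only [embedsFrom, List.any_eq_true, Bool.or_eq_true, Bool.and_eq_true] at h
    obtain ⟨q, hq, ⟨⟨h1, h2⟩, h3⟩ | ⟨⟨h1, h2⟩, h3⟩⟩ := h
    · exact fin q hq _ _ (by simp) (hL q hq) h1 h2 h3
    · exact fin q hq _ _ (by simp) (hL q hq).symm h1 h2 h3

theorem Realizes.ne (h : Realizes G R L) (hp : p ∈ L) : p.1 ≠ p.2 := by
  obtain ⟨e, he, u, v, rfl, hu, hv⟩ := h.2 p hp
  exact fun hc => G.ne_of_adj he ((h.1 hu hv).1 hc)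

theorem Contains.of_embeds (h : Contains G L) (hF : ∀ p ∈ F, p.1 ≠ p.2)
    (hFL : embeds F L = true) : Contains G F := by
  obtain ⟨R, hR⟩ := h
  simp only [embeds, Bool.and_eq_true] at hFL
  obtain ⟨t, -, ht, hFt⟩ := exists_of_embedsFrom (fun q hq => hR.ne hq) hF
    (by intro a u b v h; simp at h) hFL.2
  -- Compose the relabelling found by the search with the realization of `L`.
  refine ⟨fun a u => ∃ c, (a, c) ∈ t ∧ R c u, ?_, fun p hp => ?_⟩
  · rintro a u b v ⟨c, hac, hcu⟩ ⟨d, hbd, hdv⟩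
    rw [ht hac hbd, hR.1 hcu hdv]
  · obtain ⟨q, hq, c, d, hm, hc, hd⟩ := hFt p hp
    obtain ⟨e, he, u, v, rfl, hu, hv⟩ := hR.2 q hq
    refine ⟨_, he, ?_⟩
    simp only [List.mem_cons, Prod.mk.injEq, List.not_mem_nil, or_false] at hm
    rcases hm with ⟨rfl, rfl⟩ | ⟨rfl, rfl⟩
    · exact ⟨u, v, rfl, ⟨_, hc, hu⟩, ⟨_, hd, hv⟩⟩
    · exact ⟨v, u, Sym2.eq_swap, ⟨_, hc, hv⟩, ⟨_, hd, hu⟩⟩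

/-! ### Jump graphs of edge lists -/

theorem mem_jump {i j : ℕ} : (i, j) ∈ jump L ↔
    ∃ p q, L[i]? = some p ∧ L[j]? = some q ∧ i < j ∧ disjointPairs p q = true := by
  simp only [jump, List.mem_flatMap, List.mem_map, List.mem_filter, Bool.and_eq_true, Nat.blt_eq,
    Prod.mk.injEq]
  constructor
  · rintro ⟨⟨p, i⟩, hp, ⟨q, j⟩, ⟨hq, hij, hd⟩, rfl, rfl⟩
    rw [List.mk_mem_zipIdx_iff_getElem?] at hp hq
    exact ⟨p, q, hp, hq, hij, hd⟩
  · rintro ⟨p, q, hp, hq, hij, hd⟩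
    rw [← List.mk_mem_zipIdx_iff_getElem?] at hp hq
    exact ⟨(p, i), hp, (q, j), ⟨hq, hij, hd⟩, rfl, rfl⟩

theorem eq_of_samePair (hL : simple L = true) {i j : ℕ} (hp : L[i]? = some p)
    (hq : L[j]? = some q) (h : samePair p q = true) : i = j := by
  simp only [simple, List.all_eq_true] at hL
  have := hL (p, i) (List.mk_mem_zipIdx_iff_getElem?.2 hp) (q, j)
    (List.mk_mem_zipIdx_iff_getElem?.2 hq)
  simpa [h] using this

/-- The edge of `G` at a position of an edge list. -/
def EdgeAt (G : SimpleGraph V) (R : ℕ → V → Prop) (L : EdgeList) (i : ℕ) (e : G.edgeSet) : Prop :=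
  ∃ p, L[i]? = some p ∧ MapsTo R p e

/-- Without repeated edges, a position in `L` and the edge of `G` it stands for determine each
other. -/
theorem Realizes.jump (h : Realizes G R L) (hL : simple L = true) :
    Realizes (jumpGraph G) (EdgeAt G R L) (jump L) := by
  refine ⟨?_, ?_⟩
  · rintro i e j f ⟨p, hp, hpe⟩ ⟨q, hq, hqf⟩
    constructor
    · rintro rfl
      obtain rfl : p = q := by simpa [hp] using hq
      exact Subtype.ext ((samePair_iff h.1 hpe hqf).1 (by simp [samePair]))
    · rintro rfl
      exact eq_of_samePair hL hp hq ((samePair_iff h.1 hpe hqf).2 rfl)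
  · rintro ⟨i, j⟩ hij
    obtain ⟨p, q, hp, hq, -, hd⟩ := mem_jump.1 hij
    obtain ⟨e, he, hpe⟩ := h.2 p (List.mem_of_getElem? hp)
    obtain ⟨f, hf, hqf⟩ := h.2 q (List.mem_of_getElem? hq)
    exact ⟨s(⟨e, he⟩, ⟨f, hf⟩), (disjointPairs_iff h.1 hpe hqf).1 hd,
      ⟨e, he⟩, ⟨f, hf⟩, rfl, ⟨p, hp, hpe⟩, ⟨q, hq, hqf⟩⟩

theorem Contains.jump (h : Contains G L) (hL : simple L = true) :
    Contains (jumpGraph G) (jump L) :=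
  let ⟨_, hR⟩ := h
  ⟨_, hR.jump hL⟩

theorem IsGraph.jump (h : IsGraph G L) (hL : simple L = true) :
    IsGraph (jumpGraph G) (jump L) := by
  obtain ⟨R, hR, hall⟩ := h
  refine ⟨_, hR.jump hL, fun x => ?_⟩
  induction x with
  | _ e f =>
    intro hef
    obtain ⟨p, hp, hpe⟩ := hall e e.2
    obtain ⟨q, hq, hqf⟩ := hall f f.2
    have hd := (disjointPairs_iff hR.1 hpe hqf).2 hef
    have hd' := (disjointPairs_iff hR.1 hqf hpe).2 ((jumpGraph G).adj_symm hef)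
    obtain ⟨i, hi⟩ := List.mem_iff_getElem?.1 hp
    obtain ⟨j, hj⟩ := List.mem_iff_getElem?.1 hq
    rcases lt_trichotomy i j with hij | rfl | hij
    · exact ⟨(i, j), mem_jump.2 ⟨p, q, hi, hj, hij, hd⟩, e, f, rfl, ⟨p, hi, hpe⟩, ⟨q, hj, hqf⟩⟩
    · obtain rfl : p = q := by simpa [hi] using hj
      simp [disjointPairs] at hd
    · exact ⟨(j, i), mem_jump.2 ⟨q, p, hj, hi, hij, hd'⟩, f, e, Sym2.eq_swap,
        ⟨q, hj, hqf⟩, ⟨p, hi, hpe⟩⟩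

theorem isEmpty_edgeSet_of_isGraph (h : IsGraph G []) : IsEmpty G.edgeSet := by
  obtain ⟨R, -, h⟩ := h
  exact ⟨fun e => by simpa using h e e.2⟩

theorem isEmpty_of_dissipates {n k : ℕ} (h : IsGraph (iterJump G k).2 L)
    (hL : dissipates n L = true) : ∃ m, IsEmpty (iterJump G m).1 := by
  have nil : ∀ k L, IsGraph (iterJump G k).2 L → L.isEmpty = true →
      ∃ m, IsEmpty (iterJump G m).1 := by
    intro k L h hL
    rw [List.isEmpty_iff] at hL
    subst hL
    -- Isolated vertices may survive in the `k`-th iterate, but not in the next one.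
    exact ⟨k + 1, isEmpty_edgeSet_of_isGraph h⟩
  induction n generalizing k L with
  | zero => exact nil k L h hL
  | succ n ih =>
    simp only [dissipates, Bool.or_eq_true, Bool.and_eq_true] at hL
    rcases hL with hL | ⟨hs, hL⟩
    · exact nil k L h hL
    · exact ih (k := k + 1) (h.jump hs) hL

/-! ### Adding an edge -/

/-- Both, one or none of the ends of `e` already carry labels; unlabelled ends receive the fresh
labels `n` and, if needed, `n + 1`. The ends are ordered by label, as in `newEdges`. -/
theorem exists_extension {n : ℕ} (hR : IsPartialBij R) (hn : ∀ a u, R a u → a < n)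
    (he : ¬ e.IsDiag) :
    ∃ R' : ℕ → V → Prop, IsPartialBij R' ∧ (∀ a u, R a u → R' a u) ∧
      ∃ q ∈ newEdges n, MapsTo R' q e ∧ ∀ a u, R' a u → a < max n (q.2 + 1) := by
  have key : ∀ u v, u ≠ v → (∃ a b, R a u ∧ R b v ∧ a < b) ∨
      ((∃ a, R a u) ∧ ¬ ∃ b, R b v) ∨ ((¬ ∃ a, R a u) ∧ ¬ ∃ b, R b v) →
      ∃ R' : ℕ → V → Prop, IsPartialBij R' ∧ (∀ a u, R a u → R' a u) ∧
      ∃ q ∈ newEdges n, MapsTo R' q s(u, v) ∧ ∀ a u, R' a u → a < max n (q.2 + 1) := by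
    rintro u v huv (⟨a, b, ha, hb, hab⟩ | ⟨⟨a, ha⟩, hv⟩ | ⟨hu, hv⟩)
    · have := hn _ _ hb
      refine ⟨R, hR, fun _ _ h => h, (a, b), ?_, ⟨u, v, rfl, ha, hb⟩, ?_⟩
      · simp [newEdges]
        omega
      · intro c w h
        exact lt_max_of_lt_left (hn c w h)
    · have := hn _ _ ha
      refine ⟨fun c w => R c w ∨ (c = n ∧ w = v), ?_, fun _ _ h => Or.inl h, (a, n), ?_,
        ⟨u, v, rfl, Or.inl ha, Or.inr ⟨rfl, rfl⟩⟩, ?_⟩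
      · intro c w d x hc hd
        have := @hR c w d x
        grind
      · simp [newEdges]
        omega
      · rintro c w (h | ⟨rfl, -⟩)
        · exact lt_max_of_lt_left (hn c w h)
        · simp
    · refine ⟨fun c w => R c w ∨ (c = n ∧ w = u) ∨ (c = n + 1 ∧ w = v), ?_,
        fun _ _ h => Or.inl h, (n, n + 1), ?_,
        ⟨u, v, rfl, Or.inr (Or.inl ⟨rfl, rfl⟩), Or.inr (Or.inr ⟨rfl, rfl⟩)⟩, ?_⟩
      · intro c w d x hc hd
        have := @hR c w d x
        grind
      · simp [newEdges]
      · rintro c w (h | ⟨rfl, -⟩ | ⟨rfl, -⟩)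
        · exact lt_max_of_lt_left (hn c w h)
        · simp
        · simp
  induction e with
  | _ u v =>
    have huv : u ≠ v := by simpa using he
    by_cases hu : ∃ a, R a u <;> by_cases hv : ∃ b, R b v
    · obtain ⟨a, ha⟩ := hu
      obtain ⟨b, hb⟩ := hv
      rcases lt_trichotomy a b with hab | hab | hab
      · exact key u v huv (Or.inl ⟨a, b, ha, hb, hab⟩)
      · exact absurd ((hR ha hb).1 hab) huv
      · rw [Sym2.eq_swap]
        exact key v u huv.symm (Or.inl ⟨b, a, hb, ha, hab⟩)
    · exact key u v huv (Or.inr (Or.inl ⟨hu, hv⟩))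
    · rw [Sym2.eq_swap]
      exact key v u huv.symm (Or.inr (Or.inl ⟨hv, hu⟩))
    · exact key u v huv (Or.inr (Or.inr ⟨hu, hv⟩))

theorem lt_bound (hp : p ∈ L) : p.1 < bound L ∧ p.2 < bound L := by
  induction L with
  | nil => simp at hp
  | cons q L ih =>
    simp only [bound, List.foldr_cons] at ih ⊢
    rcases List.mem_cons.1 hp with rfl | hp
    · omega
    · have := ih hp
      omega

theorem Contains.grow {targets : List EdgeList} (h : Contains G L) (hL : grows targets L = true)
    (hT : ∀ F ∈ targets, ∀ p ∈ F, p.1 ≠ p.2) :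
    IsGraph G L ∨ ∃ F ∈ targets, Contains G F := by
  obtain ⟨R, hR, hRL⟩ := h
  by_cases hall : ∀ e ∈ G.edgeSet, ∃ p ∈ L, MapsTo R p e
  · exact Or.inl ⟨R, ⟨hR, hRL⟩, hall⟩
  push Not at hall
  obtain ⟨e, he, hne⟩ := hall
  -- `R` may also relate labels not occurring in `L`; discarding those from `bound L` on makes the
  -- new labels fresh.
  obtain ⟨R', hR', hRR', q, hq, hqe, -⟩ := exists_extension (n := bound L)
    (R := fun a u => R a u ∧ a < bound L) (fun a u b v ha hb => hR ha.1 hb.1)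
    (fun a u h => h.2) (G.not_isDiag_of_mem_edgeSet he)
  have hext : ∀ p ∈ L, ∃ f ∈ G.edgeSet, MapsTo R p f ∧ MapsTo R' p f := by
    intro p hp
    obtain ⟨f, hf, hpf⟩ := hRL p hp
    refine ⟨f, hf, hpf, ?_⟩
    obtain ⟨u, v, rfl, hu, hv⟩ := hpf
    exact ⟨u, v, rfl, hRR' _ _ ⟨hu, (lt_bound hp).1⟩, hRR' _ _ ⟨hv, (lt_bound hp).2⟩⟩
  have hcont : Contains G (q :: L) := by
    refine ⟨R', hR', fun p hp => ?_⟩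
    rcases List.mem_cons.1 hp with rfl | hp
    · exact ⟨e, he, hqe⟩
    · obtain ⟨f, hf, -, hpf⟩ := hext p hp
      exact ⟨f, hf, hpf⟩
  simp only [grows, List.all_eq_true, Bool.or_eq_true, List.any_eq_true] at hL
  rcases hL q hq with ⟨p, hp, hqp⟩ | ⟨F, hF, hFL⟩
  · obtain ⟨f, hf, hpf, hpf'⟩ := hext p hp
    rw [samePair_iff hR' hqe hpf'] at hqp
    exact absurd (hqp ▸ hpf) (hne p hp)
  · exact Or.inr ⟨F, hF, hcont.of_embeds (hT F hF) hFL⟩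

end Contains

/-! ### Iterated jump graphs -/

section Iterated

variable {V : Type u} {G : SimpleGraph V}

/-- Some iterated jump graph of `G` contains the pentagon or the net. -/
def Accumulating (G : SimpleGraph V) : Prop :=
  ∃ k, Contains (iterJump G k).2 pentagon ∨ Contains (iterJump G k).2 net

theorem accumulating_of_descends {T : List EdgeList} (hT : descends T = true)
    (hne : ∀ F ∈ T, ∀ p ∈ F, p.1 ≠ p.2) {F : EdgeList} (hF : F ∈ T) {k : ℕ}
    (h : Contains (iterJump G k).2 F) : Accumulating G := by
  induction T generalizing F k with
  | nil => simp at hF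
  | cons F' T ih =>
    simp only [descends, Bool.and_eq_true, Bool.or_eq_true, List.any_eq_true] at hT
    obtain ⟨hF', hT⟩ := hT
    have ih := fun F hF k h => @ih hT (fun F hF => hne F (List.mem_cons_of_mem _ hF)) F hF k h
    rcases List.mem_cons.1 hF with rfl | hF
    · rcases hF' with (h5 | hN) | ⟨hs, F', hF', hJ⟩
      · exact ⟨k, Or.inl (h.of_embeds (by decide) h5)⟩
      · exact ⟨k, Or.inr (h.of_embeds (by decide) hN)⟩
      · exact ih F' hF' (k + 1)
          (Contains.of_embeds (h.jump hs) (hne F' (List.mem_cons_of_mem _ hF')) hJ)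
    · exact ih F hF k h

theorem persistent_ne : ∀ F ∈ persistent, ∀ p ∈ F, p.1 ≠ p.2 := by decide

theorem accumulating_of_persistent {F : EdgeList} (hF : F ∈ persistent) {k : ℕ}
    (h : Contains (iterJump G k).2 F) : Accumulating G :=
  accumulating_of_descends descends_persistent persistent_ne hF h

/-- If `J(G)` has two edges without a common end, then `G` contains a graph in `transientFour`. -/
theorem exists_transientFour [Nonempty (jumpGraph (jumpGraph G)).edgeSet] :
    ∃ F ∈ transientFour, Contains G F := by
  obtain ⟨x, hx⟩ := ‹Nonempty (jumpGraph (jumpGraph G)).edgeSet›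
  induction x with
  | _ x y =>
  obtain ⟨x, hx'⟩ := x
  obtain ⟨y, hy'⟩ := y
  induction x with
  | _ a b =>
  induction y with
  | _ c d =>
  have hxy : ¬ ∃ z, z ∈ s(a, b) ∧ z ∈ s(c, d) := hx
  have hab : ¬ ∃ z, z ∈ (a : Sym2 V) ∧ z ∈ (b : Sym2 V) := hx'
  have hcd : ¬ ∃ z, z ∈ (c : Sym2 V) ∧ z ∈ (d : Sym2 V) := hy'
  have hac : (a : Sym2 V) ≠ c := fun h => hxy ⟨a, by simp, by simp [Subtype.ext h]⟩
  have had : (a : Sym2 V) ≠ d := fun h => hxy ⟨a, by simp, by simp [Subtype.ext h]⟩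
  have hbc : (b : Sym2 V) ≠ c := fun h => hxy ⟨b, by simp, by simp [Subtype.ext h]⟩
  have hbd : (b : Sym2 V) ≠ d := fun h => hxy ⟨b, by simp, by simp [Subtype.ext h]⟩
  -- Label the four edges one after another, starting from the empty labelling.
  obtain ⟨R₁, h₁, -, p, hp, hpa, hb₁⟩ := exists_extension (n := 0) (R := fun _ _ => False)
    (e := a) (fun _ _ _ _ h => h.elim) (fun _ _ h => h.elim) (G.not_isDiag_of_mem_edgeSet a.2)
  obtain rfl : p = (0, 1) := by simpa [newEdges] using hp
  obtain ⟨R₂, h₂, m₂, q, hq, hqb, hb₂⟩ := exists_extension h₁ hb₁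
    (G.not_isDiag_of_mem_edgeSet b.2)
  obtain ⟨R₃, h₃, m₃, r, hr, hrc, hb₃⟩ := exists_extension h₂ hb₂
    (G.not_isDiag_of_mem_edgeSet c.2)
  obtain ⟨R₄, h₄, m₄, t, ht, htd, -⟩ := exists_extension h₃ hb₃
    (G.not_isDiag_of_mem_edgeSet d.2)
  have hpa := ((hpa.mono m₂).mono m₃).mono m₄
  have hqb := (hqb.mono m₃).mono m₄
  have hrc := hrc.mono m₄
  have key := two_disjoint_pairs
  simp only [List.all_eq_true, Bool.or_eq_true, Bool.not_eq_true', List.any_eq_true,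
    ← Bool.not_eq_true] at key
  have key := (key q hq).resolve_left (not_not.2 ((disjointPairs_iff h₄ hpa hqb).2 hab)) r hr
  rw [samePair_iff h₄ hpa hrc, samePair_iff h₄ hqb hrc] at key
  have key := (key.resolve_left (not_or.2 ⟨hac, hbc⟩)) t ht
  rw [samePair_iff h₄ hpa htd, samePair_iff h₄ hqb htd, disjointPairs_iff h₄ hrc htd] at key
  obtain ⟨F, hF, hFL⟩ := key.resolve_left
    (not_or.2 ⟨not_or.2 ⟨had, hbd⟩, not_not.2 hcd⟩)
  refine ⟨F, hF, Contains.of_embeds ⟨R₄, h₄, ?_⟩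
    ((by decide : ∀ F ∈ transientFour, ∀ p ∈ F, p.1 ≠ p.2) F hF) hFL⟩
  simp only [List.forall_mem_cons]
  exact ⟨⟨a, a.2, hpa⟩, ⟨b, b.2, hqb⟩, ⟨c, c.2, hrc⟩, ⟨d, d.2, htd⟩, by simp⟩

/-- If `G` were a graph of `T` up to isolated vertices, it would dissipate, contrary to `hG`; hence
it has one more edge. -/
theorem Contains.grow_transient {T T' : List EdgeList}
    (hT : T.all (grows (T' ++ persistent)) = true)
    (hd : T.all (dissipates 7) = true) (hne : ∀ F ∈ T', ∀ p ∈ F, p.1 ≠ p.2)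
    (hG : ∀ k, Nonempty (iterJump G k).1) (h : ∃ F ∈ T, Contains G F) :
    Accumulating G ∨ ∃ F ∈ T', Contains G F := by
  obtain ⟨F, hF, h⟩ := h
  rw [List.all_eq_true] at hT hd
  have hne' : ∀ F ∈ T' ++ persistent, ∀ p ∈ F, p.1 ≠ p.2 := fun F hF =>
    (List.mem_append.1 hF).elim (hne F) (persistent_ne F)
  rcases h.grow (hT F hF) hne' with h | ⟨F', hF', h⟩
  · obtain ⟨m, hm⟩ := isEmpty_of_dissipates (k := 0) h (hd F hF)
    exact absurd (hG m) (not_nonempty_iff.2 hm)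
  · rcases List.mem_append.1 hF' with hF' | hF'
    · exact Or.inr ⟨F', hF', h⟩
    · exact Or.inl (accumulating_of_persistent (k := 0) hF' h)

theorem accumulating_of_nonempty (hG : ∀ k, Nonempty (iterJump G k).1) : Accumulating G := by
  have hd := dissipates_of_transient
  rw [List.all_append, List.all_append, Bool.and_eq_true, Bool.and_eq_true] at hd
  obtain ⟨⟨h4, h5⟩, h6⟩ := hd
  have : Nonempty (jumpGraph (jumpGraph G)).edgeSet := hG 3
  rcases Contains.grow_transient grows_transientFour h4 (by decide) hG exists_transientFour
    with h | h
  · exact h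
  rcases Contains.grow_transient grows_transientFive h5 (by decide) hG h with h | h
  · exact h
  rcases Contains.grow_transient (T' := []) grows_transientSix h6 (by decide) hG h with h | h
  · exact h
  · simp at h

theorem nonempty_of_contains {L : EdgeList} (hL : L ≠ [])
    (hJ : (simple L && embeds L (jump L)) = true) {k : ℕ} (h : Contains (iterJump G k).2 L) (m : ℕ) :
    Nonempty (iterJump G m).1 := by
  rw [Bool.and_eq_true] at hJ
  have step : ∀ m, Contains (iterJump G (k + m)).2 L := by
    intro m
    induction m with
    | zero => exact h
    | succ m ih =>
      obtain ⟨R, hR⟩ := ih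
      exact Contains.of_embeds (Contains.jump ⟨R, hR⟩ hJ.1) (fun p hp => hR.ne hp) hJ.2
  -- A vertex of an iterate is an edge of the preceding one, whose ends are vertices there.
  have anti : ∀ j, Nonempty (iterJump G (m + j)).1 → Nonempty (iterJump G m).1 := by
    intro j
    induction j with
    | zero => exact id
    | succ j ih =>
      rintro ⟨e⟩
      change (iterJump G (m + j)).2.edgeSet at e
      exact ih ⟨(e : Sym2 (iterJump G (m + j)).1).out.1⟩
  refine anti k ?_
  obtain ⟨R, -, hR⟩ := step m
  obtain ⟨p, hp⟩ := List.exists_mem_of_ne_nil L hL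
  obtain ⟨-, -, u, -⟩ := hR p hp
  rw [add_comm]
  exact ⟨u⟩

theorem dInfinite_iff_nonempty : DInfinite G ↔ ∀ k, Nonempty (iterJump G k).1 := by
  simp only [DInfinite, dissipationNumber, sInf_eq_top, Set.mem_ofPred_eq]
  constructor
  · intro h k
    by_contra hk
    exact ENat.natCast_ne_top k (h k ⟨k, rfl, not_nonempty_iff.1 hk⟩)
  · rintro h _ ⟨k, -, hk⟩
    exact absurd (h k) (not_nonempty_iff.2 hk)

theorem dInfinite_iff_accumulating : DInfinite G ↔ Accumulating G := by
  rw [dInfinite_iff_nonempty]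
  refine ⟨accumulating_of_nonempty, ?_⟩
  rintro ⟨k, h | h⟩
  · exact nonempty_of_contains (by decide) embeds_pentagon_jump h
  · exact nonempty_of_contains (by decide) embeds_net_jump h

/-- `Contains` sees only edges, so `hL` excludes isolated vertices of `H`. -/
theorem contains_iff_isContained {n : ℕ} {H : SimpleGraph (Fin n)} {L : EdgeList}
    (hH : ∀ i j : Fin n, H.Adj i j ↔ (i.val, j.val) ∈ L ∨ (j.val, i.val) ∈ L)
    (hlt : ∀ p ∈ L, p.1 < n ∧ p.2 < n) (hL : ∀ i : Fin n, ∃ p ∈ L, p.1 = i ∨ p.2 = i) :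
    Contains G L ↔ H ⊑ G := by
  constructor
  · rintro ⟨R, hR, hRL⟩
    have hex : ∀ i : Fin n, ∃ u, R i u := by
      intro i
      obtain ⟨p, hp, hi⟩ := hL i
      obtain ⟨e, -, u, v, -, hu, hv⟩ := hRL p hp
      rcases hi with hi | hi
      · exact ⟨u, hi ▸ hu⟩
      · exact ⟨v, hi ▸ hv⟩
    choose f hf using hex
    have hadj : ∀ i j : Fin n, (i.val, j.val) ∈ L → G.Adj (f i) (f j) := by
      intro i j hij
      obtain ⟨e, he, u, v, rfl, hu, hv⟩ := hRL _ hij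
      rw [(hR (hf i) hu).1 rfl, (hR (hf j) hv).1 rfl]
      exact he
    refine ⟨⟨⟨f, fun {i j} hij => ?_⟩, fun i j hij => Fin.ext ((hR (hf i) (hf j)).2 hij)⟩⟩
    rcases (hH i j).1 hij with h | h
    · exact hadj i j h
    · exact (hadj j i h).symm
  · rintro ⟨φ⟩
    refine ⟨fun a u => ∃ h : a < n, φ ⟨a, h⟩ = u, ?_, fun p hp => ?_⟩
    · rintro a _ b _ ⟨ha, rfl⟩ ⟨hb, rfl⟩
      exact ⟨fun h => by subst h; rfl, fun h => Fin.mk.inj (φ.injective h)⟩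
    · obtain ⟨h1, h2⟩ := hlt p hp
      exact ⟨s(φ ⟨p.1, h1⟩, φ ⟨p.2, h2⟩), φ.toHom.map_adj ((hH _ _).2 (Or.inl hp)), _, _, rfl,
        ⟨h1, rfl⟩, ⟨h2, rfl⟩⟩

theorem contains_pentagon_iff : Contains G pentagon ↔ SimpleGraph.cycleGraph 5 ⊑ G :=
  contains_iff_isContained (by decide) (by decide) (by decide)

theorem contains_net_iff : Contains G net ↔ netGraph ⊑ G := by
  refine contains_iff_isContained ?_ (by decide) (by decide)
  simp only [netGraph, SimpleGraph.fromEdgeSet_adj, Set.mem_insert_iff, Set.mem_singleton_iff]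
  decide

end Iterated

end EdgeList

theorem theorem4 {V : Type u} [Finite V] (G : SimpleGraph V) :
    DInfinite G ↔
      (Accumulates G (SimpleGraph.cycleGraph 5) ∨ Accumulates G netGraph) := by
  rw [EdgeList.dInfinite_iff_accumulating, Accumulates, Accumulates, ← exists_or]
  simp only [EdgeList.Accumulating, EdgeList.contains_pentagon_iff, EdgeList.contains_net_iff]
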